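/- Let $d\ge 1$, let $R_d=\mathbb Z[z_1^{\pm1},\dots,z_d^{\pm1}]$ be the ring of Laurent polynomials with integer coefficients, write $z^{n}=z_1^{n_1}\cdots z_d^{n_d}$ for $n\in\mathbb Z^d$, and for $g=\sum_{n}g_n z^{n}\in R_d$ and $m\ge1$ put $g(z^m)=\sum_n g_n z^{mn}$. For $m\ge 1$ call $f\in R_d$ *$m$-good* if the following two conditions hold. (C1) For every nonzero $g=\sum_n\varepsilon_n z^n\in R_d$ with all $\varepsilon_n\in\{-2,-1,0,1,2\}$, the polynomial $g(z^m)$ is not divisible by $f$ in $R_d$. (C2) For every $k\in\{0,1,\dots,m-1\}^d\smallsetminus\{0\}$, all $n\neq n'$ in $\mathbb Z^d$, and every nonzero $g=\sum_l\varepsilon_l z^l\in R_d$ with all $\varepsilon_l\in\{-1,0,1\}$, the polynomial $z^{mn+k}-z^{mn'+k}+g(z^m)$ is not divisible by $f$ in $R_d$. For $f=\sum_k f_kz^k\in R_d$ let $X_f=\{x\in\mathbb T^{\mathbb Z^d} : \sum_{k} f_k x_{n+k}=0 \text{ for all } n\in\mathbb Z^d\}$, where $\mathbb T=\mathbb R/\mathbb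 Z$; this is a compact group in the topology induced by the product topology. Let $\alpha_f$ be the $\mathbb Z^d$-action on $X_f$ by shifts, $(\alpha_f^{m}x)_{n}=x_{n+m}$. A continuous $\mathbb Z^d$-action $\alpha$ on a compact space $X$ is *Bohr chaotic* if for every bounded $w:\mathbb N^d\to\mathbb C$ with $$\limsup_{N\to\infty}\frac1{N^d}\sum_{n\in[0,N-1]^d}|w_n|>0$$ there exist a continuous function $\phi:X\to\mathbb C$ and a point $x\in X$ such that $$\limsup_{N\to\infty}\frac1{N^d}\Bigl|\sum_{n\in[0,N-1]^d}w_n\,\phi(\alpha^{n}x)\Bigr|>0 .$$ **Theorem.** If $f\in R_d$ is $m$-good for some positive integer $m$, then $(X_f,\alpha_f)$ is Bohr chaotic. -/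

import Mathlib

open Filter Topology

noncomputable section

namespace BohrChaos

/-! ### Weights and Bohr chaotic actions -/

/-- The box `[0, N-1]^d` in `ℕ^d`. -/
def box (d N : ℕ) : Finset (Fin d → ℕ) :=
  Fintype.piFinset fun _ => Finset.range N

/-- A non-trivial weight: a bounded family `w : ℕ^d → ℂ` whose absolute values have positive
upper mean along the boxes `[0, N-1]^d`. -/
def IsNontrivialWeight {d : ℕ} (w : (Fin d → ℕ) → ℂ) : Prop :=
  (∃ C : ℝ, ∀ n, ‖w n‖ ≤ C) ∧
    0 < limsup (fun N : ℕ => (1 / (N : ℝ) ^ d) * ∑ n ∈ box d N, ‖w n‖) atTop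

/-- The homeomorphism `α^n` for `n ∈ ℕ^d ⊆ ℤ^d`. -/
def actNat {d : ℕ} {X : Type*} [TopologicalSpace X]
    (α : Multiplicative (Fin d → ℤ) →* (X ≃ₜ X)) (n : Fin d → ℕ) : X ≃ₜ X :=
  α (Multiplicative.ofAdd fun i => (n i : ℤ))

/-- A continuous `ℤ^d`-action `α` on a compact space `X` is Bohr chaotic if every non-trivial
weight correlates with `φ(α^n x)` for some continuous `φ : X → ℂ` and some point `x`. -/
def IsBohrChaotic {d : ℕ} {X : Type*} [TopologicalSpace X] [CompactSpace X]
    (α : Multiplicative (Fin d → ℤ) →* (X ≃ₜ X)) : Prop :=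
  ∀ w : (Fin d → ℕ) → ℂ, IsNontrivialWeight w →
    ∃ (φ : C(X, ℂ)) (x : X),
      0 < limsup (fun N : ℕ =>
        (1 / (N : ℝ) ^ d) * ‖∑ n ∈ box d N, w n * φ (actNat α n x)‖) atTop

/-! ### Principal algebraic actions -/

/-- The ring `ℤ[z₁^{±1}, …, z_d^{±1}]` of integer Laurent polynomials in `d` variables. -/
abbrev LaurentRing (d : ℕ) : Type := AddMonoidAlgebra ℤ (Fin d → ℤ)

/-- The monomial `z^n`. -/
def mono {d : ℕ} (n : Fin d → ℤ) : LaurentRing d := AddMonoidAlgebra.single n 1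

/-- The group `X_f` of all `x ∈ 𝕋^{ℤ^d}`, `𝕋 = ℝ/ℤ`, with `∑ₖ fₖ x_{n+k} = 0` for all `n`. -/
def principalGroup {d : ℕ} (f : LaurentRing d) :
    AddSubgroup ((Fin d → ℤ) → UnitAddCircle) where
  carrier := {x | ∀ n, ∑ k ∈ f.coeff.support, f.coeff k • x (n + k) = 0}
  zero_mem' := by intro n; simp
  add_mem' := by
    intro x y hx hy n
    simp only [Pi.add_apply, smul_add, Finset.sum_add_distrib]
    rw [hx n, hy n, add_zero]
  neg_mem' := by
    intro x hx n
    simp only [Pi.neg_apply, smul_neg, Finset.sum_neg_distrib]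
    rw [hx n, neg_zero]

theorem mem_principalGroup {d : ℕ} {f : LaurentRing d} {x : (Fin d → ℤ) → UnitAddCircle} :
    x ∈ principalGroup f ↔ ∀ n, ∑ k ∈ f.coeff.support, f.coeff k • x (n + k) = 0 :=
  Iff.rfl

theorem isClosed_principalGroup {d : ℕ} (f : LaurentRing d) :
    IsClosed (principalGroup f : Set ((Fin d → ℤ) → UnitAddCircle)) := by
  have h : (principalGroup f : Set ((Fin d → ℤ) → UnitAddCircle)) =
      ⋂ n, {x | ∑ k ∈ f.coeff.support, f.coeff k • x (n + k) = 0} := by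
    ext x
    simp [mem_principalGroup]
  rw [h]
  exact isClosed_iInter fun n => isClosed_eq (by fun_prop) continuous_const

/-- `X_f` is compact in the topology induced by the product topology. -/
instance {d : ℕ} (f : LaurentRing d) : CompactSpace (principalGroup f) :=
  isCompact_iff_compactSpace.mp (isClosed_principalGroup f).isCompact

/-- The shift by `m` on `X_f`: `(shift m x)_n = x_{n+m}`. -/
def shift {d : ℕ} (f : LaurentRing d) (m : Fin d → ℤ) (x : principalGroup f) :
    principalGroup f :=
  ⟨fun n => x.1 (n + m), fun n => by
    have h := x.2 (n + m)
    simpa only [add_right_comm] using h⟩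

theorem continuous_shift {d : ℕ} (f : LaurentRing d) (m : Fin d → ℤ) :
    Continuous (shift f m) := by
  refine Continuous.subtype_mk (continuous_pi fun n => ?_) _
  exact (continuous_apply (n + m)).comp continuous_subtype_val

theorem shift_shift {d : ℕ} (f : LaurentRing d) (m m' : Fin d → ℤ) (x : principalGroup f) :
    shift f m (shift f m' x) = shift f (m + m') x := by
  apply Subtype.ext
  funext n
  simp only [shift]
  rw [add_assoc]

theorem shift_zero {d : ℕ} (f : LaurentRing d) (x : principalGroup f) : shift f 0 x = x := by
  apply Subtype.ext
  funext n
  simp only [shift]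
  rw [add_zero]

/-- The principal algebraic action `α_f` of `ℤ^d` on `X_f`: the restriction of the shift. -/
def principalAction {d : ℕ} (f : LaurentRing d) :
    Multiplicative (Fin d → ℤ) →* (principalGroup f ≃ₜ principalGroup f) where
  toFun m :=
    { toFun := shift f m.toAdd
      invFun := shift f (-m.toAdd)
      left_inv := fun x => by rw [shift_shift, neg_add_cancel, shift_zero]
      right_inv := fun x => by rw [shift_shift, add_neg_cancel, shift_zero]
      continuous_toFun := continuous_shift f _
      continuous_invFun := continuous_shift f _ }
  map_one' := by
    ext1 x
    exact shift_zero f x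
  map_mul' m m' := by
    ext1 x
    exact (shift_shift f m.toAdd m'.toAdd x).symm

/-! ### `m`-good polynomials -/

/-- The substitution `g(z) ↦ g(z^m)`, which sends each monomial `z^n` to `z^{mn}`. -/
def expand {d : ℕ} (m : ℕ) (g : LaurentRing d) : LaurentRing d :=
  AddMonoidAlgebra.mapDomain (fun n => m • n) g

/-- `f` is `m`-good (for `m ≥ 1`). In `C2`, `k` runs over the representatives in
`[0, m-1]^d ∖ {0}` of the nonzero residues modulo `m`. -/
structure IsGood {d : ℕ} (m : ℕ) (f : LaurentRing d) : Prop where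
  C1 : ∀ g : LaurentRing d, g ≠ 0 → (∀ n, |g.coeff n| ≤ 2) → ¬ f ∣ expand m g
  C2 : ∀ k : Fin d → ℤ, (∀ i, 0 ≤ k i ∧ k i < m) → k ≠ 0 →
    ∀ n n' : Fin d → ℤ, n ≠ n' →
    ∀ g : LaurentRing d, g ≠ 0 → (∀ l, |g.coeff l| ≤ 1) →
      ¬ f ∣ mono (m • n + k) - mono (m • n' + k) + expand m g

end BohrChaos

end

noncomputable section

namespace BohrChaos

open MeasureTheory ComplexConjugate

/-! ### Characters of `X_f` -/

/-! Take `φ(x) = exp(2πi x₀)`, so that `φ(α^n x)` is the character `χₙ` of `z^n`. By pigeonhole some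
residue class `j` modulo `m` carries a positive share of `∑ |wₙ|` for infinitely many boxes. Let
`aₙ` be the conjugate phase of `wₙ` and weight Haar measure by the Riesz product `∏ (1 + Re(āₙ χₙ))`
over finitely many `n` in that class.

(C1) makes these monomials dissociate (`IsGood.dissociate`). Hence the product is a probability
density, `χₙ` has mean `aₙ/2`, and the centred `χₙ - aₙ/2` are orthogonal. (C2) makes distinct `χₙ`,
`χₙ'` orthogonal when `n`, `n'` share a class other than `j`
(`IsGood.integral_centred_mul_eq_zero`). With Cauchy–Schwarz over the `m^d` classes, the centred sum
over a box of side `N` has second moment `O(N^d)`, while centring removes `½ ∑ |wₙ|` over class `j`,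
which is of order `N^d`.

Chebyshev's inequality along a sparse sequence of boxes gives, for any finitely many of them, one
point where all their sums are large (`IsGood.exists_norm_sum_centred_lt`). Compactness of `X_f`
gives one point for all. -/

/-- The pairing `g ↦ ∑ₙ gₙ xₙ` of Laurent polynomials with a point of `𝕋^{ℤ^d}`. -/
def pairing {d : ℕ} (x : (Fin d → ℤ) → UnitAddCircle) : LaurentRing d →+ UnitAddCircle :=
  (Finsupp.liftAddHom fun n => (smulAddHom ℤ UnitAddCircle).flip (x n)).comp
    (AddMonoidAlgebra.coeffAddEquiv : LaurentRing d ≃+ _).toAddMonoidHom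

theorem pairing_apply {d : ℕ} (x : (Fin d → ℤ) → UnitAddCircle) (g : LaurentRing d) :
    pairing x g = ∑ n ∈ g.coeff.support, g.coeff n • x n := by
  simp [pairing, Finsupp.sum]

@[simp]
theorem pairing_single {d : ℕ} (x : (Fin d → ℤ) → UnitAddCircle) (n : Fin d → ℤ) (c : ℤ) :
    pairing x (AddMonoidAlgebra.single n c) = c • x n := by
  simp [pairing]

theorem pairing_add_left {d : ℕ} (x y : (Fin d → ℤ) → UnitAddCircle) (g : LaurentRing d) :
    pairing (x + y) g = pairing x g + pairing y g := by
  simp [pairing_apply, Finset.sum_add_distrib]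

theorem continuous_pairing {d : ℕ} (g : LaurentRing d) :
    Continuous fun x : (Fin d → ℤ) → UnitAddCircle => pairing x g := by
  simp only [pairing_apply]
  fun_prop

theorem pairing_mul_single {d : ℕ} (x : (Fin d → ℤ) → UnitAddCircle) (f : LaurentRing d)
    (n : Fin d → ℤ) (c : ℤ) :
    pairing x (f * AddMonoidAlgebra.single n c) =
      c • ∑ k ∈ f.coeff.support, f.coeff k • x (n + k) := by
  have h : ((pairing x).comp (AddMonoidHom.mulRight (AddMonoidAlgebra.single n c))) =
      c • pairing (fun k => x (n + k)) := by
    refine AddMonoidAlgebra.addMonoidHom_ext fun k b => ?_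
    simp [AddMonoidAlgebra.single_mul_single, smul_smul, mul_comm]
  have := DFunLike.congr_fun h f
  simpa [pairing_apply] using this

/-- The relation at `n` says that the pairing kills `f z^n`, and these products span the ideal `(f)`
additively. -/
theorem mem_principalGroup_iff_pairing {d : ℕ} {f : LaurentRing d}
    {x : (Fin d → ℤ) → UnitAddCircle} :
    x ∈ principalGroup f ↔ ∀ g, f ∣ g → pairing x g = 0 := by
  constructor
  · rintro hx _ ⟨g, rfl⟩
    have h : (pairing x).comp (AddMonoidHom.mulLeft f) = 0 := by
      refine AddMonoidAlgebra.addMonoidHom_ext fun n c => ?_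
      simp [pairing_mul_single, hx n]
    exact DFunLike.congr_fun h g
  · intro h n
    have := h _ ⟨mono n, rfl⟩
    rwa [mono, pairing_mul_single, one_smul] at this

/-- The inclusion `ℚ/ℤ → ℝ/ℤ`. -/
def ratCircleHom : AddCircle (1 : ℚ) →+ UnitAddCircle :=
  QuotientAddGroup.map _ _ (Rat.castHom ℝ).toAddMonoidHom (by
    intro q hq
    obtain ⟨k, rfl⟩ := AddSubgroup.mem_zmultiples_iff.mp hq
    exact AddSubgroup.mem_zmultiples_iff.mpr ⟨k, by simp⟩)

theorem ratCircleHom_injective : Function.Injective ratCircleHom := by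
  rw [injective_iff_map_eq_zero]
  intro a ha
  induction a using QuotientAddGroup.induction_on with
  | H q =>
    have h : ((q : ℝ) : UnitAddCircle) = 0 := ha
    rw [AddCircle.coe_eq_zero_iff] at h
    obtain ⟨k, hk⟩ := h
    refine (AddCircle.coe_eq_zero_iff (1 : ℚ)).mpr ⟨k, ?_⟩
    have : ((k : ℚ) : ℝ) = (q : ℝ) := by simpa using hk
    simpa using (Rat.cast_injective this : (k : ℚ) = q)

/-- This is the part of Pontryagin duality that is needed. Homomorphisms to `ℚ/ℤ` separate the
points of `R_d/(f)`, and such a homomorphism `ψ` yields the point `xₙ = ψ(z^n)`. -/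
theorem exists_pairing_ne_zero {d : ℕ} {f g : LaurentRing d} (h : ¬ f ∣ g) :
    ∃ x ∈ principalGroup f, pairing x g ≠ 0 := by
  have hg : Ideal.Quotient.mk (Ideal.span {f}) g ≠ 0 := by
    rwa [Ne, Ideal.Quotient.eq_zero_iff_mem, Ideal.mem_span_singleton]
  obtain ⟨c, hc⟩ := CharacterModule.exists_character_apply_ne_zero_of_ne_zero hg
  set ψ : LaurentRing d →+ UnitAddCircle := (ratCircleHom.comp c).comp
    (Ideal.Quotient.mk (Ideal.span {f})).toAddMonoidHom with hψ
  have hp : pairing (fun n => ψ (mono n)) = ψ := by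
    refine AddMonoidAlgebra.addMonoidHom_ext fun n b => ?_
    rw [pairing_single, ← map_zsmul, mono, AddMonoidAlgebra.smul_single, smul_eq_mul, mul_one]
  refine ⟨fun n => ψ (mono n), mem_principalGroup_iff_pairing.mpr fun g' hg' => ?_, ?_⟩
  · have : Ideal.Quotient.mk (Ideal.span {f}) g' = 0 := by
      rwa [Ideal.Quotient.eq_zero_iff_mem, Ideal.mem_span_singleton]
    rw [hp]
    change ratCircleHom (c (Ideal.Quotient.mk (Ideal.span {f}) g')) = 0
    rw [this, map_zero, map_zero]
  · rw [hp]
    change ratCircleHom (c (Ideal.Quotient.mk (Ideal.span {f}) g)) ≠ 0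
    rw [Ne, map_eq_zero_iff _ ratCircleHom_injective]
    exact hc

/-- The character of `X_f` defined by the Laurent polynomial `g`. -/
def character {d : ℕ} (f g : LaurentRing d) (x : principalGroup f) : ℂ :=
  (AddCircle.toCircle (pairing x.1 g) : ℂ)

section character

variable {d : ℕ} {f : LaurentRing d}

@[simp]
theorem character_zero (x : principalGroup f) : character f 0 x = 1 := by
  simp [character]

theorem character_add (g h : LaurentRing d) (x : principalGroup f) :
    character f (g + h) x = character f g x * character f h x := by
  simp [character, AddCircle.toCircle_add]

theorem character_neg (g : LaurentRing d) (x : principalGroup f) :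
    character f (-g) x = conj (character f g x) := by
  simp [character, AddCircle.toCircle_neg, -Circle.coe_inv, Circle.coe_inv_eq_conj]

theorem character_sum {ι : Type*} (s : Finset ι) (g : ι → LaurentRing d) (x : principalGroup f) :
    character f (∑ i ∈ s, g i) x = ∏ i ∈ s, character f (g i) x := by
  classical
  induction s using Finset.induction_on with
  | empty => simp
  | insert i s hi ih => rw [Finset.sum_insert hi, Finset.prod_insert hi, character_add, ih]

@[simp]
theorem norm_character (g : LaurentRing d) (x : principalGroup f) : ‖character f g x‖ = 1 :=
  Circle.norm_coe _

theorem character_add_point (g : LaurentRing d) (x y : principalGroup f) :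
    character f g (x + y) = character f g x * character f g y := by
  simp [character, pairing_add_left, AddCircle.toCircle_add]

@[fun_prop]
theorem continuous_character (g : LaurentRing d) : Continuous (character f g) :=
  continuous_subtype_val.comp (AddCircle.continuous_toCircle.comp
    ((continuous_pairing g).comp continuous_subtype_val))

theorem character_eq_one_of_dvd {g : LaurentRing d} (h : f ∣ g) (x : principalGroup f) :
    character f g x = 1 := by
  simp [character, mem_principalGroup_iff_pairing.mp x.2 g h]

theorem exists_character_ne_one {g : LaurentRing d} (h : ¬ f ∣ g) :
    ∃ x, character f g x ≠ 1 := by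
  obtain ⟨x, hx, hg⟩ := exists_pairing_ne_zero h
  refine ⟨⟨x, hx⟩, fun h1 => hg ?_⟩
  apply AddCircle.injective_toCircle (T := (1 : ℝ)) one_ne_zero
  ext
  simpa [character] using h1

end character

/-! ### Haar measure on `X_f` and integrals of characters. -/

instance {d : ℕ} (f : LaurentRing d) : MeasurableSpace (principalGroup f) := borel _

instance {d : ℕ} (f : LaurentRing d) : BorelSpace (principalGroup f) := ⟨rfl⟩

/-- The normalised Haar measure of `X_f`. -/
def haar {d : ℕ} (f : LaurentRing d) : Measure (principalGroup f) :=
  Measure.addHaarMeasure ⊤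

instance {d : ℕ} (f : LaurentRing d) : IsProbabilityMeasure (haar f) :=
  ⟨Measure.addHaarMeasure_self⟩

instance {d : ℕ} (f : LaurentRing d) : (haar f).IsAddLeftInvariant :=
  inferInstanceAs (Measure.addHaarMeasure ⊤).IsAddLeftInvariant

theorem integrable_haar {d : ℕ} {f : LaurentRing d} {E : Type*} [NormedAddCommGroup E]
    [SecondCountableTopology E] {u : principalGroup f → E} (hu : Continuous u) :
    Integrable u (haar f) :=
  hu.integrable_of_hasCompactSupport (HasCompactSupport.of_compactSpace u)

open Classical in
-- If `f ∤ g`, translating by a point where the character is not `1` multiplies the integral by a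
-- factor other than `1`, so it vanishes.
theorem integral_character {d : ℕ} (f g : LaurentRing d) :
    ∫ x, character f g x ∂haar f = if f ∣ g then 1 else 0 := by
  split_ifs with h
  · simp [character_eq_one_of_dvd h]
  · obtain ⟨y, hy⟩ := exists_character_ne_one h
    have h1 := integral_add_left_eq_self (μ := haar f) (character f g) y
    simp only [character_add_point, integral_const_mul] at h1
    have h2 : (character f g y - 1) * ∫ x, character f g x ∂haar f = 0 := by
      rw [sub_mul, h1, one_mul, sub_self]
    exact (mul_eq_zero.mp h2).resolve_left (sub_ne_zero.mpr hy)

/-! ### Finite Riesz products -/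

/-- The family `v` of Laurent polynomials has no nontrivial relations with coefficients in
`{-2, …, 2}` modulo `f`. -/
def Dissociate {d : ℕ} {ι : Type*} [Fintype ι] (f : LaurentRing d) (v : ι → LaurentRing d) : Prop :=
  ∀ δ : ι → ℤ, (∀ i, |δ i| ≤ 2) → f ∣ ∑ i, δ i • v i → δ = 0

/-- The Riesz product `∏ᵢ (1 + Re (āᵢ χᵢ))`, where `χᵢ` is the character of `vᵢ`. -/
def rieszDensity {d : ℕ} {ι : Type*} [Fintype ι] (f : LaurentRing d) (v : ι → LaurentRing d)
    (a : ι → ℂ) (x : principalGroup f) : ℝ :=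
  ∏ i, (1 + (conj (a i) * character f (v i) x).re)

/-- The Fourier coefficients of a factor `1 + Re (ā χ)` of a Riesz product. -/
def rieszCoeff (a : ℂ) : SignType → ℂ
  | .zero => 1
  | .pos => conj a / 2
  | .neg => a / 2

@[simp] theorem rieszCoeff_zero (a : ℂ) : rieszCoeff a 0 = 1 := rfl
@[simp] theorem rieszCoeff_one (a : ℂ) : rieszCoeff a 1 = conj a / 2 := rfl
@[simp] theorem rieszCoeff_neg_one (a : ℂ) : rieszCoeff a (-1) = a / 2 := rfl

section riesz

variable {d : ℕ} {ι : Type*} [Fintype ι] {f : LaurentRing d} {v : ι → LaurentRing d} {a : ι → ℂ}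

@[fun_prop]
theorem continuous_rieszDensity : Continuous (rieszDensity f v a) := by
  unfold rieszDensity
  fun_prop

theorem rieszDensity_nonneg (ha : ∀ i, ‖a i‖ ≤ 1) (x : principalGroup f) :
    0 ≤ rieszDensity f v a x := by
  refine Finset.prod_nonneg fun i _ => ?_
  have h := (abs_le.mp (Complex.abs_re_le_norm (conj (a i) * character f (v i) x))).1
  rw [norm_mul, norm_character, mul_one, RCLike.norm_conj] at h
  linarith [ha i]

theorem riesz_factor_eq_sum (a : ℂ) (g : LaurentRing d) (x : principalGroup f) :
    ((1 + (conj a * character f g x).re : ℝ) : ℂ) =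
      ∑ s : SignType, rieszCoeff a s * character f ((s : ℤ) • g) x := by
  have h : (Finset.univ : Finset SignType) = {0, -1, 1} := rfl
  rw [h, Finset.sum_insert (by decide), Finset.sum_insert (by decide), Finset.sum_singleton]
  push_cast
  rw [Complex.re_eq_add_conj]
  simp [character_neg]
  ring

theorem rieszDensity_eq_sum [DecidableEq ι] (x : principalGroup f) :
    (rieszDensity f v a x : ℂ) = ∑ s : ι → SignType, (∏ i, rieszCoeff (a i) (s i)) *
      character f (∑ i, (s i : ℤ) • v i) x := by
  rw [rieszDensity, Complex.ofReal_prod]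
  simp only [riesz_factor_eq_sum, character_sum]
  rw [Finset.prod_univ_sum]
  simp [Finset.prod_mul_distrib]

open Classical in
theorem integral_character_mul_rieszDensity (h : LaurentRing d) :
    ∫ x, character f h x * rieszDensity f v a x ∂haar f =
      ∑ s : ι → SignType, (∏ i, rieszCoeff (a i) (s i)) *
        if f ∣ h + ∑ i, (s i : ℤ) • v i then 1 else 0 := by
  simp only [rieszDensity_eq_sum, Finset.mul_sum, mul_left_comm (character f h _),
    ← character_add]
  rw [integral_finsetSum]
  · simp only [integral_const_mul, integral_character]
  · intro s _
    exact integrable_haar (by fun_prop)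

theorem integral_character_mul_rieszDensity_eq_zero {h : LaurentRing d}
    (hh : ∀ s : ι → SignType, ¬ f ∣ h + ∑ i, (s i : ℤ) • v i) :
    ∫ x, character f h x * rieszDensity f v a x ∂haar f = 0 := by
  classical
  rw [integral_character_mul_rieszDensity]
  exact Finset.sum_eq_zero fun s _ => by rw [if_neg (hh s), mul_zero]

/-- Only the term `t` of the Fourier expansion survives: a second one would give a relation with
coefficients `s i - t i`. This is why `Dissociate` allows coefficients up to `2`. -/
theorem integral_character_mul_rieszDensity_of_dissociate (hv : Dissociate f v)
    (t : ι → SignType) {h : LaurentRing d} (hh : h + ∑ i, (t i : ℤ) • v i = 0) :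
    ∫ x, character f h x * rieszDensity f v a x ∂haar f = ∏ i, rieszCoeff (a i) (t i) := by
  classical
  rw [integral_character_mul_rieszDensity, Finset.sum_eq_single t]
  · rw [hh, if_pos (dvd_zero f), mul_one]
  · intro s _ hst
    rw [if_neg, mul_zero]
    intro hdvd
    apply hst
    have h1 : h + ∑ i, (s i : ℤ) • v i = ∑ i, ((s i : ℤ) - t i) • v i := by
      rw [eq_neg_of_add_eq_zero_left hh]
      simp only [sub_smul, Finset.sum_sub_distrib]
      abel
    rw [h1] at hdvd
    have h2 := hv _ (fun i => by generalize s i = p; generalize t i = q; revert p q; decide) hdvd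
    funext i
    have h3 : (s i : ℤ) - t i = 0 := congrFun h2 i
    revert h3
    generalize s i = p; generalize t i = q; revert p q; decide
  · simp

theorem integral_rieszDensity_ofReal (hv : Dissociate f v) :
    ∫ x, (rieszDensity f v a x : ℂ) ∂haar f = 1 := by
  have := integral_character_mul_rieszDensity_of_dissociate (a := a) hv 0 (h := 0) (by simp)
  simpa using this

theorem integral_rieszDensity (hv : Dissociate f v) : ∫ x, rieszDensity f v a x ∂haar f = 1 := by
  have h := integral_rieszDensity_ofReal (a := a) hv
  rw [integral_complex_ofReal] at h
  exact_mod_cast h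

theorem integral_character_single_mul_rieszDensity (hv : Dissociate f v) (i : ι) :
    ∫ x, character f (v i) x * rieszDensity f v a x ∂haar f = a i / 2 := by
  classical
  -- The factor at `i` must supply the inverse of `χᵢ`, whose coefficient is `aᵢ/2`.
  rw [integral_character_mul_rieszDensity_of_dissociate hv (Pi.single i (-1)),
    Finset.prod_eq_single i]
  · simp
  · intro j _ hj
    simp [hj]
  · simp
  · rw [Finset.sum_eq_single i]
    · simp
    · intro j _ hj
      simp [hj]
    · simp

theorem integral_conj_character_single_mul_rieszDensity (hv : Dissociate f v) (i : ι) :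
    ∫ x, conj (character f (v i) x) * rieszDensity f v a x ∂haar f = conj (a i) / 2 := by
  have h := congrArg conj (integral_character_single_mul_rieszDensity (a := a) hv i)
  rw [← integral_conj] at h
  simpa only [map_mul, map_div₀, Complex.conj_ofReal, map_ofNat] using h

theorem integral_character_pair_mul_rieszDensity (hv : Dissociate f v) {i j : ι} (hij : i ≠ j) :
    ∫ x, character f (v i) x * conj (character f (v j) x) * rieszDensity f v a x ∂haar f =
      a i / 2 * (conj (a j) / 2) := by
  classical
  simp only [← character_neg, ← character_add]
  rw [integral_character_mul_rieszDensity_of_dissociate hv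
    (Function.update (Pi.single i (-1)) j 1), Finset.prod_eq_mul i j hij]
  · simp [hij]
  · rintro k _ ⟨hki, hkj⟩
    simp [hki, hkj]
  · simp
  · simp
  · rw [Finset.sum_eq_add i j hij]
    · simp only [Function.update_of_ne hij, Function.update_self, Pi.single_eq_same,
        SignType.coe_neg, SignType.coe_one, neg_smul, one_smul]
      abel
    · rintro k _ ⟨hki, hkj⟩
      simp [hki, hkj]
    · simp
    · simp

/-- The centred characters `χᵢ - aᵢ/2` are orthogonal with respect to the Riesz product. -/
theorem integral_centred_mul_rieszDensity (hv : Dissociate f v) {i j : ι} (hij : i ≠ j) :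
    ∫ x, (character f (v i) x - a i / 2) * conj (character f (v j) x - a j / 2) *
      rieszDensity f v a x ∂haar f = 0 := by
  have h : ∀ x, (character f (v i) x - a i / 2) * conj (character f (v j) x - a j / 2) *
      rieszDensity f v a x =
      character f (v i) x * conj (character f (v j) x) * rieszDensity f v a x
        - conj (a j) / 2 * (character f (v i) x * rieszDensity f v a x)
        - a i / 2 * (conj (character f (v j) x) * rieszDensity f v a x)
        + a i / 2 * (conj (a j) / 2) * rieszDensity f v a x := by
    intro x
    simp only [map_sub, map_div₀, map_ofNat]
    ring
  have hc : Continuous fun x : principalGroup f => conj (character f (v j) x) :=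
    Complex.continuous_conj.comp (continuous_character _)
  have hr : Continuous fun x => (rieszDensity f v a x : ℂ) :=
    Complex.continuous_ofReal.comp continuous_rieszDensity
  simp only [h]
  rw [integral_add, integral_sub, integral_sub]
  · simp only [integral_const_mul, integral_character_pair_mul_rieszDensity hv hij,
      integral_character_single_mul_rieszDensity hv, integral_rieszDensity_ofReal hv,
      integral_conj_character_single_mul_rieszDensity hv]
    ring
  all_goals exact integrable_haar (by fun_prop)

end riesz

/-! ### Second moments -/

theorem integral_norm_sq_sum_le {d : ℕ} {f : LaurentRing d} {ι : Type*} (T : Finset ι)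
    (Y : ι → principalGroup f → ℂ) (hY : ∀ i, Continuous (Y i)) {B C : ℝ} (hB : ∀ i x, ‖Y i x‖ ≤ B)
    (w : ι → ℂ) (hw : ∀ i, ‖w i‖ ≤ C)
    (ρ : principalGroup f → ℝ) (hρc : Continuous ρ) (hρ : ∀ x, 0 ≤ ρ x)
    (hρ1 : ∫ x, ρ x ∂haar f = 1)
    (horth : ∀ i ∈ T, ∀ j ∈ T, i ≠ j → ∫ x, Y i x * conj (Y j x) * ρ x ∂haar f = 0) :
    ∫ x, ‖∑ i ∈ T, w i * Y i x‖ ^ 2 * ρ x ∂haar f ≤ T.card * (C * B) ^ 2 := by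
  have hrc : Continuous fun x => (ρ x : ℂ) := Complex.continuous_ofReal.comp hρc
  have hcc : ∀ i, Continuous fun x => conj (Y i x) := fun i => Complex.continuous_conj.comp (hY i)
  -- Pythagoras: the off-diagonal terms vanish by `horth`.
  have key : ∫ x, ‖∑ i ∈ T, w i * Y i x‖ ^ 2 * ρ x ∂haar f =
      ∑ i ∈ T, ∫ x, ‖w i * Y i x‖ ^ 2 * ρ x ∂haar f := by
    have hsq : ∀ z : ℂ, ((‖z‖ ^ 2 : ℝ) : ℂ) = z * conj z := fun z => by
      rw [Complex.mul_conj, Complex.normSq_eq_norm_sq]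
    apply Complex.ofReal_injective
    push_cast
    simp only [← integral_complex_ofReal]
    push_cast
    simp only [← Complex.ofReal_pow, hsq, map_sum, Finset.sum_mul_sum]
    simp only [Finset.sum_mul]
    rw [integral_finsetSum _ fun i _ => integrable_finsetSum _ fun j _ =>
      integrable_haar (by fun_prop)]
    refine Finset.sum_congr rfl fun i hi => ?_
    rw [integral_finsetSum _ fun j _ => integrable_haar (by fun_prop), Finset.sum_eq_single i]
    · intro j hj hji
      have h : ∀ x, w i * Y i x * conj (w j * Y j x) * (ρ x : ℂ) =
          w i * conj (w j) * (Y i x * conj (Y j x) * ρ x) := by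
        intro x
        rw [map_mul]
        ring
      simp only [h, integral_const_mul, horth i hi j hj hji.symm, mul_zero]
    · exact fun h => absurd hi h
  rw [key, ← nsmul_eq_mul]
  refine Finset.sum_le_card_nsmul _ _ _ fun i _ => ?_
  calc ∫ x, ‖w i * Y i x‖ ^ 2 * ρ x ∂haar f
      ≤ ∫ x, (C * B) ^ 2 * ρ x ∂haar f := by
        refine integral_mono (integrable_haar (by fun_prop)) (integrable_haar (by fun_prop))
          fun x => ?_
        refine mul_le_mul_of_nonneg_right ?_ (hρ x)
        rw [norm_mul]
        have := hw i
        have := hB i x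
        have : 0 ≤ C := (norm_nonneg _).trans (hw i)
        gcongr
    _ = (C * B) ^ 2 := by rw [integral_const_mul, hρ1, mul_one]

/-! ### Consequences of `m`-goodness -/

section good

variable {d m : ℕ} {f : LaurentRing d}

theorem mono_add (n k : Fin d → ℤ) : (mono (n + k) : LaurentRing d) = mono k * mono n := by
  simp [mono, AddMonoidAlgebra.single_mul_single, add_comm]

theorem isUnit_mono (n : Fin d → ℤ) : IsUnit (mono n : LaurentRing d) := by
  refine IsUnit.of_mul_eq_one (mono (-n)) ?_
  rw [← mono_add, neg_add_cancel]
  rfl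

theorem expand_sum_smul_mono {ι : Type*} (s : Finset ι) (δ : ι → ℤ) (b : ι → Fin d → ℤ) :
    expand m (∑ i ∈ s, δ i • mono (b i)) = ∑ i ∈ s, δ i • (mono (m • b i) : LaurentRing d) := by
  classical
  induction s using Finset.induction_on with
  | empty => simp [expand]
  | insert i s hi ih =>
    rw [Finset.sum_insert hi, Finset.sum_insert hi, ← ih, expand, AddMonoidAlgebra.mapDomain_add]
    simp [expand, mono]

theorem coeff_sum_smul_mono {ι : Type*} [Fintype ι] (δ : ι → ℤ) {b : ι → Fin d → ℤ}
    (hb : Function.Injective b) (i : ι) :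
    (∑ i, δ i • (mono (b i) : LaurentRing d)).coeff (b i) = δ i := by
  rw [AddMonoidAlgebra.coeff_sum, Finsupp.finsetSum_apply, Finset.sum_eq_single i]
  · simp [mono]
  · intro j _ hj
    simp [mono, hb.ne hj]
  · simp

theorem abs_coeff_sum_smul_mono_le {ι : Type*} [Fintype ι] {δ : ι → ℤ} {b : ι → Fin d → ℤ}
    (hb : Function.Injective b) {B : ℤ} (hB : 0 ≤ B) (hδ : ∀ i, |δ i| ≤ B) (n : Fin d → ℤ) :
    |(∑ i, δ i • (mono (b i) : LaurentRing d)).coeff n| ≤ B := by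
  by_cases hn : ∃ i, b i = n
  · obtain ⟨i, rfl⟩ := hn
    rw [coeff_sum_smul_mono δ hb]
    exact hδ i
  · push Not at hn
    rw [AddMonoidAlgebra.coeff_sum, Finsupp.finsetSum_apply, Finset.sum_eq_zero]
    · simpa using hB
    · intro i _
      simp [mono, hn i]

/-- The monomial `z^c` is a unit, so (C1) passes from `mℤ^d` to each of its cosets. -/
theorem IsGood.dissociate (hf : IsGood m f) {ι : Type*} [Fintype ι] {b : ι → Fin d → ℤ}
    (hb : Function.Injective b) (c : Fin d → ℤ) :
    Dissociate f fun i => mono (m • b i + c) := by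
  intro δ hδ hdvd
  by_contra hne
  refine hf.C1 (∑ i, δ i • mono (b i)) (fun h => hne ?_)
    (abs_coeff_sum_smul_mono_le hb (by norm_num) hδ) ?_
  · funext i
    rw [← coeff_sum_smul_mono δ hb i, h]
    rfl
  · rw [expand_sum_smul_mono, ← (isUnit_mono c).dvd_mul_left, Finset.mul_sum]
    simpa only [mono_add _ c, mul_smul_comm] using hdvd

theorem IsGood.not_dvd (hf : IsGood m f) {ι : Type*} [Fintype ι] {b : ι → Fin d → ℤ}
    (hb : Function.Injective b) (c : Fin d → ℤ) {k : Fin d → ℤ} (hk : ∀ i, 0 ≤ k i ∧ k i < m)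
    (hk0 : k ≠ 0) {n n' : Fin d → ℤ} (hn : n ≠ n') (s : ι → ℤ) (hs : ∀ i, |s i| ≤ 1) :
    ¬ f ∣ mono (m • n + k + c) - mono (m • n' + k + c) + ∑ i, s i • mono (m • b i + c) := by
  intro hdvd
  have h1 : f ∣ mono (m • n + k) - mono (m • n' + k) + expand m (∑ i, s i • mono (b i)) := by
    rw [expand_sum_smul_mono, ← (isUnit_mono c).dvd_mul_left, mul_add, mul_sub, Finset.mul_sum]
    simpa only [mono_add _ c, mul_smul_comm] using hdvd
  -- (C2) requires `g ≠ 0`. For `g = 0` the difference of two monomials in one coset is excluded by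
  -- (C1).
  by_cases hg : (∑ i, s i • mono (b i) : LaurentRing d) = 0
  · have h2 : Function.Injective ![n, n'] := by
      intro i j
      fin_cases i <;> fin_cases j <;> simp [hn, hn.symm]
    have h3 := hf.dissociate h2 k ![1, -1] (fun i => by fin_cases i <;> simp) (by
      rw [hg] at h1
      simpa [Fin.sum_univ_two, expand, sub_eq_add_neg] using h1)
    simpa using congrFun h3 0
  · exact hf.C2 k hk hk0 n n' hn _ hg (abs_coeff_sum_smul_mono_le hb (by norm_num) hs) h1

end good

/-! ### Residue classes in `ℕ^d` and centred characters. -/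

/-- The monomial `z^n` for `n ∈ ℕ^d`. -/
def monoNat {d : ℕ} (n : Fin d → ℕ) : LaurentRing d := mono fun i => (n i : ℤ)

/-- The coordinatewise residue of `n ∈ ℕ^d` modulo `m`. -/
def residue {d : ℕ} (m : ℕ) (n : Fin d → ℕ) : Fin d → ℕ := fun i => n i % m

section residue

variable {d m : ℕ} {f : LaurentRing d} {j : Fin d → ℕ} {Q : Finset (Fin d → ℕ)}

theorem monoNat_eq_of_residue {n : Fin d → ℕ} (hn : residue m n = j) :
    monoNat n = mono (m • (fun i => ((n i / m : ℕ) : ℤ)) + fun i => (j i : ℤ)) := by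
  rw [monoNat]
  congr 1
  funext i
  rw [← hn]
  simp only [Pi.add_apply, Pi.smul_apply, residue]
  rw [nsmul_eq_mul]
  exact_mod_cast (Nat.div_add_mod (n i) m).symm

theorem injective_quotient (hQ : ∀ n ∈ Q, residue m n = j) :
    Function.Injective fun (n : Q) (i : Fin d) => ((n.1 i / m : ℕ) : ℤ) := by
  intro n n' h
  refine Subtype.ext (funext fun i => ?_)
  have h1 : n.1 i / m = n'.1 i / m := Nat.cast_injective (R := ℤ) (congrFun h i)
  have h2 : n.1 i % m = n'.1 i % m :=
    congrFun ((hQ n n.2).trans (hQ n' n'.2).symm) i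
  rw [← Nat.div_add_mod (n.1 i) m, h1, h2, Nat.div_add_mod]

theorem IsGood.dissociate_monoNat (hf : IsGood m f) (hQ : ∀ n ∈ Q, residue m n = j) :
    Dissociate f fun n : Q => monoNat n.1 := by
  have h := hf.dissociate (injective_quotient hQ) fun i => (j i : ℤ)
  convert h using 2 with n
  exact monoNat_eq_of_residue (hQ n n.2)

theorem IsGood.not_dvd_monoNat (hf : IsGood m f) (hm : 1 ≤ m) (hj : ∀ i, j i < m)
    (hQ : ∀ n ∈ Q, residue m n = j) {n n' : Fin d → ℕ} (hn : n ≠ n')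
    (hr : residue m n = residue m n') (hnj : residue m n ≠ j) (s : Q → ℤ) (hs : ∀ q, |s q| ≤ 1) :
    ¬ f ∣ monoNat n - monoNat n' + ∑ q, s q • monoNat q.1 := by
  have hm0 : (0 : ℤ) < m := by exact_mod_cast hm
  have hmod : ∀ i, ((n i : ℤ) - j i) % m = ((n' i : ℤ) - j i) % m := by
    intro i
    refine Int.ModEq.sub_right _ ?_
    exact_mod_cast (congrFun hr i : n i % m = n' i % m)
  -- Dividing by `z^j` moves `Q` into `mℤ^d`. Since `n - j` may have negative coordinates, `k` is
  -- its integer remainder, which is nonzero because `n` is outside class `j`.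
  have key := hf.not_dvd (injective_quotient hQ) (fun i => (j i : ℤ))
    (k := fun i => ((n i : ℤ) - j i) % m)
    (n := fun i => ((n i : ℤ) - j i) / m) (n' := fun i => ((n' i : ℤ) - j i) / m)
    (fun i => ⟨Int.emod_nonneg _ hm0.ne', Int.emod_lt_of_pos _ hm0⟩)
    (fun h0 => hnj ?_) (fun h => hn ?_) s hs
  · have h1 : monoNat n = (mono (m • (fun i => ((n i : ℤ) - j i) / m) +
        (fun i => ((n i : ℤ) - j i) % m) + fun i => (j i : ℤ)) : LaurentRing d) := by
      rw [monoNat]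
      congr 1
      funext i
      simp only [Pi.add_apply, Pi.smul_apply]
      rw [nsmul_eq_mul, Int.mul_ediv_add_emod, sub_add_cancel]
    have h2 : monoNat n' = (mono (m • (fun i => ((n' i : ℤ) - j i) / m) +
        (fun i => ((n i : ℤ) - j i) % m) + fun i => (j i : ℤ)) : LaurentRing d) := by
      rw [monoNat]
      congr 1
      funext i
      simp only [Pi.add_apply, Pi.smul_apply]
      rw [nsmul_eq_mul, hmod, Int.mul_ediv_add_emod, sub_add_cancel]
    have h3 : ∀ q : Q, monoNat q.1 = _ := fun q => monoNat_eq_of_residue (hQ q q.2)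
    simp only [h1, h2, h3]
    exact key
  · funext i
    have h1 : (n i : ℤ) ≡ j i [ZMOD m] :=
      (Int.modEq_iff_dvd.mpr (Int.dvd_of_emod_eq_zero (congrFun h0 i))).symm
    have h2 : n i % m = j i % m := by exact_mod_cast h1
    rw [residue, h2, Nat.mod_eq_of_lt (hj i)]
  · funext i
    have h1 := Int.mul_ediv_add_emod ((n i : ℤ) - j i) m
    have h2 := Int.mul_ediv_add_emod ((n' i : ℤ) - j i) m
    have h3 : ((n i : ℤ) - j i) / m = ((n' i : ℤ) - j i) / m := congrFun h i
    rw [h3, hmod i, h2] at h1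
    omega

/-- The character of `z^n`, centred with respect to the Riesz product when `n` lies in the residue
class `j`. -/
def centred (f : LaurentRing d) (m : ℕ) (j : Fin d → ℕ) (a : (Fin d → ℕ) → ℂ) (n : Fin d → ℕ)
    (x : principalGroup f) : ℂ :=
  open Classical in character f (monoNat n) x - if residue m n = j then a n / 2 else 0

variable {a : (Fin d → ℕ) → ℂ}

theorem continuous_centred (n : Fin d → ℕ) : Continuous (centred f m j a n) := by
  unfold centred
  fun_prop

theorem norm_centred_le (ha : ∀ n, ‖a n‖ ≤ 1) (n : Fin d → ℕ) (x : principalGroup f) :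
    ‖centred f m j a n x‖ ≤ 2 := by
  refine (norm_sub_le _ _).trans ?_
  rw [norm_character]
  have := ha n
  split_ifs
  · rw [norm_div, Complex.norm_ofNat]
    linarith
  · simp

/-- Class `j` is handled by dissociation, every other class by (C2). Outside class `j` no mean is
subtracted, and (C2) gives the orthogonality of pairs directly. -/
theorem IsGood.integral_centred_mul_eq_zero (hf : IsGood m f) (hm : 1 ≤ m) (hj : ∀ i, j i < m)
    (hQ : ∀ n ∈ Q, residue m n = j) {n n' : Fin d → ℕ} (hn : n ≠ n')
    (hr : residue m n = residue m n') (hnQ : residue m n = j → n ∈ Q)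
    (hnQ' : residue m n' = j → n' ∈ Q) :
    ∫ x, centred f m j a n x * conj (centred f m j a n' x) *
      rieszDensity f (fun q : Q => monoNat q.1) (fun q => a q.1) x ∂haar f = 0 := by
  by_cases h : residue m n = j
  · have h' := hr.symm.trans h
    have := integral_centred_mul_rieszDensity (a := fun q : Q => a q.1)
      (hf.dissociate_monoNat hQ) (i := ⟨n, hnQ h⟩) (j := ⟨n', hnQ' h'⟩) (by simpa using hn)
    simpa only [centred, if_pos h, if_pos h'] using this
  · have h' : residue m n' ≠ j := fun h' => h (hr.trans h')
    simp only [centred, if_neg h, if_neg h', sub_zero, ← character_neg, ← character_add]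
    refine integral_character_mul_rieszDensity_eq_zero fun s => ?_
    rw [← sub_eq_add_neg]
    exact hf.not_dvd_monoNat hm hj hQ hn hr h _ fun q => by
      generalize s q = p; revert p; decide

end residue

/-! ### Bohr chaoticity -/

@[simp]
theorem mem_box {d N : ℕ} {n : Fin d → ℕ} : n ∈ box d N ↔ ∀ i, n i < N := by
  simp [box]

@[simp]
theorem card_box (d N : ℕ) : (box d N).card = N ^ d := by
  simp [box]

theorem residue_mem_box {d m : ℕ} (hm : 1 ≤ m) (n : Fin d → ℕ) : residue m n ∈ box d m :=
  mem_box.mpr fun _ => Nat.mod_lt _ hm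

section main

variable {d m : ℕ} {f : LaurentRing d} {j : Fin d → ℕ} {Q : Finset (Fin d → ℕ)}
  {a w : (Fin d → ℕ) → ℂ} {C : ℝ}

theorem IsGood.integral_norm_sq_sum_centred_le (hf : IsGood m f) (hm : 1 ≤ m)
    (hj : ∀ i, j i < m) (hQ : ∀ n ∈ Q, residue m n = j) (ha : ∀ n, ‖a n‖ ≤ 1)
    (hw : ∀ n, ‖w n‖ ≤ C) (T : Finset (Fin d → ℕ)) (hT : ∀ n ∈ T, residue m n = j → n ∈ Q) :
    ∫ x, ‖∑ n ∈ T, w n * centred f m j a n x‖ ^ 2 *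
      rieszDensity f (fun q : Q => monoNat q.1) (fun q => a q.1) x ∂haar f ≤
      (m : ℝ) ^ d * (T.card * (C * 2) ^ 2) := by
  classical
  set ρ := rieszDensity f (fun q : Q => monoNat q.1) (fun q => a q.1) with hρdef
  have hρc : Continuous ρ := continuous_rieszDensity
  have hρ : ∀ x, 0 ≤ ρ x := rieszDensity_nonneg fun q => ha q.1
  have hYc : ∀ n, Continuous (centred f m j a n) := continuous_centred
  have hmaps : ∀ n ∈ T, residue m n ∈ box d m := fun n _ => residue_mem_box hm n
  have hpt : ∀ x, ‖∑ n ∈ T, w n * centred f m j a n x‖ ^ 2 * ρ x ≤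
      (m : ℝ) ^ d * ∑ k ∈ box d m,
        ‖∑ n ∈ T with residue m n = k, w n * centred f m j a n x‖ ^ 2 * ρ x := by
    intro x
    rw [← Finset.sum_mul, ← mul_assoc]
    refine mul_le_mul_of_nonneg_right ?_ (hρ x)
    rw [← Finset.sum_fiberwise_of_maps_to hmaps]
    -- Cauchy–Schwarz over the classes, since orthogonality is available only within a class. It
    -- costs the factor `m^d`.
    refine (pow_le_pow_left₀ (norm_nonneg _) (norm_sum_le _ _) 2).trans ?_
    refine (sq_sum_le_card_mul_sum_sq (s := box d m)).trans ?_
    simp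
  have hint : ∀ S : Finset (Fin d → ℕ), Continuous fun x =>
      ‖∑ n ∈ S, w n * centred f m j a n x‖ ^ 2 * ρ x := fun S => by fun_prop
  calc _ ≤ ∫ x, (m : ℝ) ^ d * ∑ k ∈ box d m,
        ‖∑ n ∈ T with residue m n = k, w n * centred f m j a n x‖ ^ 2 * ρ x ∂haar f :=
        integral_mono (integrable_haar (hint T)) (integrable_haar
          (continuous_const.mul (continuous_finsetSum _ fun k _ => hint _))) hpt
    _ = (m : ℝ) ^ d * ∑ k ∈ box d m, ∫ x,
        ‖∑ n ∈ T with residue m n = k, w n * centred f m j a n x‖ ^ 2 * ρ x ∂haar f := by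
        rw [integral_const_mul, integral_finsetSum _ fun k _ => integrable_haar (hint _)]
    _ ≤ (m : ℝ) ^ d * ∑ k ∈ box d m, ((T.filter fun n => residue m n = k).card : ℝ) *
          (C * 2) ^ 2 := by
        refine mul_le_mul_of_nonneg_left (Finset.sum_le_sum fun k _ => ?_) (by positivity)
        refine integral_norm_sq_sum_le _ _ hYc (norm_centred_le ha) w hw ρ hρc hρ
          (integral_rieszDensity (hf.dissociate_monoNat hQ)) fun n hn n' hn' hne => ?_
        rw [Finset.mem_filter] at hn hn'
        exact hf.integral_centred_mul_eq_zero hm hj hQ hne (hn.2.trans hn'.2.symm)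
          (hT n hn.1) (hT n' hn'.1)
    _ = (m : ℝ) ^ d * (T.card * (C * 2) ^ 2) := by
        rw [← Finset.sum_mul, Finset.card_eq_sum_card_fiberwise hmaps]
        push_cast
        rfl

/-- Chebyshev's inequality and a union bound, under one Riesz product whose index set covers the
class-`j` part of every `T i`. -/
theorem IsGood.exists_norm_sum_centred_lt (hf : IsGood m f) (hm : 1 ≤ m)
    (hj : ∀ i, j i < m) (ha : ∀ n, ‖a n‖ ≤ 1) (hw : ∀ n, ‖w n‖ ≤ C) {ι : Type*} (I : Finset ι)
    (T : ι → Finset (Fin d → ℕ)) (r : ι → ℝ) (hr : ∀ i, 0 < r i)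
    (hsum : ∑ i ∈ I, (m : ℝ) ^ d * ((T i).card * (C * 2) ^ 2) / r i ^ 2 < 1) :
    ∃ x, ∀ i ∈ I, ‖∑ n ∈ T i, w n * centred f m j a n x‖ < r i := by
  classical
  set Q : Finset (Fin d → ℕ) := (I.biUnion T).filter fun n => residue m n = j with hQdef
  have hQ : ∀ n ∈ Q, residue m n = j := fun n hn => (Finset.mem_filter.mp hn).2
  have hT : ∀ i ∈ I, ∀ n ∈ T i, residue m n = j → n ∈ Q := fun i hi n hn h =>
    Finset.mem_filter.mpr ⟨Finset.mem_biUnion.mpr ⟨i, hi, hn⟩, h⟩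
  set ρ := rieszDensity f (fun q : Q => monoNat q.1) (fun q => a q.1) with hρdef
  have hρc : Continuous ρ := continuous_rieszDensity
  have hρ : ∀ x, 0 ≤ ρ x := rieszDensity_nonneg fun q => ha q.1
  have hYc : ∀ n, Continuous (centred f m j a n) := continuous_centred
  have hρ1 : ∫ x, ρ x ∂haar f = 1 := integral_rieszDensity (hf.dissociate_monoNat hQ)
  by_contra! hcon
  -- If every point fails for some `i`, then integrating this bound gives `1 ≤ ∑ … < 1`.
  have hle : ∀ x, ρ x ≤ ∑ i ∈ I,
      ‖∑ n ∈ T i, w n * centred f m j a n x‖ ^ 2 * ρ x / r i ^ 2 := by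
    intro x
    obtain ⟨i, hi, hix⟩ := hcon x
    have h1 : ρ x ≤ ‖∑ n ∈ T i, w n * centred f m j a n x‖ ^ 2 * ρ x / r i ^ 2 := by
      rw [le_div_iff₀ (pow_pos (hr i) 2), mul_comm]
      exact mul_le_mul_of_nonneg_right (pow_le_pow_left₀ (hr i).le hix 2) (hρ x)
    refine h1.trans (Finset.single_le_sum (f := fun i =>
      ‖∑ n ∈ T i, w n * centred f m j a n x‖ ^ 2 * ρ x / r i ^ 2) (fun k _ => ?_) hi)
    have := hρ x
    positivity
  have hcont : ∀ i, Continuous fun x =>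
      ‖∑ n ∈ T i, w n * centred f m j a n x‖ ^ 2 * ρ x / r i ^ 2 := fun i =>
    Continuous.div_const (by fun_prop) _
  have h2 := integral_mono (integrable_haar hρc)
    (integrable_haar (continuous_finsetSum I fun i _ => hcont i)) hle
  rw [hρ1, integral_finsetSum _ fun i _ => integrable_haar (hcont i)] at h2
  simp only [integral_div] at h2
  refine absurd (h2.trans (Finset.sum_le_sum fun i hi => ?_)) hsum.not_ge
  exact div_le_div_of_nonneg_right
    (hf.integral_norm_sq_sum_centred_le hm hj hQ ha hw (T i) (hT i hi)) (by positivity)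

end main

/-! ### Choice of a residue class, sparse boxes and compactness. -/

theorem exists_residue_frequently {d m : ℕ} (hd : 1 ≤ d) (hm : 1 ≤ m) {w : (Fin d → ℕ) → ℂ}
    (hw : 0 < limsup (fun N : ℕ => (1 / (N : ℝ) ^ d) * ∑ n ∈ box d N, ‖w n‖) atTop) :
    ∃ c > 0, ∃ j : Fin d → ℕ, (∀ i, j i < m) ∧ ∃ᶠ N : ℕ in atTop,
      c * (N : ℝ) ^ d ≤ ∑ n ∈ box d N with residue m n = j, ‖w n‖ := by
  obtain ⟨c, hc0, hc⟩ := exists_between hw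
  have hm0 : (0 : ℝ) < (m : ℝ) ^ d := pow_pos (by exact_mod_cast hm) d
  have hfreq := frequently_lt_of_lt_limsup
    (isCoboundedUnder_le_of_le atTop (x := 0) fun N => by positivity) hc
  refine ⟨c / (m : ℝ) ^ d, div_pos hc0 hm0, ?_⟩
  by_contra! hcon
  have hev : ∀ j ∈ box d m, ∀ᶠ N : ℕ in atTop,
      ∑ n ∈ box d N with residue m n = j, ‖w n‖ < c / (m : ℝ) ^ d * (N : ℝ) ^ d := fun j hj => hcon j (mem_box.mp hj)
  obtain ⟨N, hN, hN'⟩ := (hfreq.and_eventually ((eventually_all_finset _).mpr hev)).exists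
  have hN0 : (0 : ℝ) < (N : ℝ) ^ d := by
    rcases Nat.eq_zero_or_pos N with rfl | h
    -- At `N = 0` the mean is `0` because `1 / 0 = 0`, which contradicts `c > 0`.
    · have hd0 : d ≠ 0 := by omega
      simp [hd0] at hN
      linarith
    · positivity
  have h1 : ∑ n ∈ box d N, ‖w n‖ < c * (N : ℝ) ^ d := by
    rw [← Finset.sum_fiberwise_of_maps_to fun n _ => residue_mem_box hm n]
    refine (Finset.sum_lt_sum_of_nonempty ?_ hN').trans_le (le_of_eq ?_)
    · exact ⟨_, residue_mem_box hm 0⟩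
    · rw [Finset.sum_const, card_box, nsmul_eq_mul]
      push_cast
      field_simp
  rw [one_div, inv_mul_eq_div, lt_div_iff₀ hN0] at hN
  linarith

/-- The unimodular (or zero) factor with `w * phase w = ‖w‖`. -/
def phase (w : ℂ) : ℂ := conj w / ‖w‖

theorem norm_phase_le (w : ℂ) : ‖phase w‖ ≤ 1 := by
  rw [phase, norm_div, RCLike.norm_conj, Complex.norm_real, norm_norm]
  exact div_self_le_one _

theorem mul_phase (w : ℂ) : w * phase w = ‖w‖ := by
  rw [phase, mul_div_assoc', Complex.mul_conj, Complex.normSq_eq_norm_sq]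
  push_cast
  rw [sq, mul_self_div_self]

/-- The phases align the means, so the subtracted main term is half the mass of `w` in class `j`. -/
theorem sum_mul_centred_phase {d m : ℕ} {f : LaurentRing d} {j : Fin d → ℕ}
    [DecidablePred fun n : Fin d → ℕ => residue m n = j] (w : (Fin d → ℕ) → ℂ)
    (T : Finset (Fin d → ℕ)) (x : principalGroup f) :
    ∑ n ∈ T, w n * centred f m j (fun n => phase (w n)) n x =
      ∑ n ∈ T, w n * character f (monoNat n) x -
        ((∑ n ∈ T with residue m n = j, ‖w n‖ : ℝ) : ℂ) / 2 := by
  rw [Finset.sum_filter, Complex.ofReal_sum, Finset.sum_div, ← Finset.sum_sub_distrib]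
  refine Finset.sum_congr rfl fun n _ => ?_
  rw [centred, mul_sub]
  split_ifs
  · rw [mul_div_assoc', mul_phase]
  · simp

theorem IsGood.exists_frequently_le_norm_sum {d m : ℕ} {f : LaurentRing d} (hf : IsGood m f)
    (hd : 1 ≤ d) (hm : 1 ≤ m) {w : (Fin d → ℕ) → ℂ} (hw : IsNontrivialWeight w) :
    ∃ c > 0, ∃ x, ∃ᶠ N : ℕ in atTop,
      0 < N ∧ c * (N : ℝ) ^ d ≤ ‖∑ n ∈ box d N, w n * character f (monoNat n) x‖ := by
  obtain ⟨⟨C, hC⟩, hlim⟩ := hw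
  obtain ⟨c, hc, j, hj, hfreq⟩ := exists_residue_frequently hd hm hlim
  have htend : Tendsto (fun N : ℕ => (m : ℝ) ^ d * (C * 2) ^ 2 / (c / 4) ^ 2 / (N : ℝ) ^ d)
      atTop (𝓝 0) :=
    Tendsto.const_div_atTop
      ((tendsto_pow_atTop (by omega)).comp tendsto_natCast_atTop_atTop) _
  -- The boxes are so sparse that the Chebyshev bounds sum to at most `1/2`.
  have hex : ∀ i : ℕ, ∃ N : ℕ, i ≤ N ∧ 0 < N ∧
      c * (N : ℝ) ^ d ≤ ∑ n ∈ box d N with residue m n = j, ‖w n‖ ∧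
      (m : ℝ) ^ d * (C * 2) ^ 2 / (c / 4) ^ 2 / (N : ℝ) ^ d ≤ 1 / 4 * (1 / 2) ^ i := by
    intro i
    have h1 := htend.eventually_le_const (show (0 : ℝ) < 1 / 4 * (1 / 2) ^ i by positivity)
    obtain ⟨N, hN, hN1, hN2, hN3⟩ :=
      (hfreq.and_eventually (h1.and ((eventually_ge_atTop i).and (eventually_gt_atTop 0)))).exists
    exact ⟨N, hN2, hN3, hN, hN1⟩
  choose N hNi hN0 hNc hNs using hex
  have hNd : ∀ i, (0 : ℝ) < (N i : ℝ) ^ d := fun i => pow_pos (by exact_mod_cast hN0 i) d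
  set S : ℕ → principalGroup f → ℂ := fun i x =>
    ∑ n ∈ box d (N i), w n * character f (monoNat n) x with hS
  have hSc : ∀ i, Continuous (S i) := fun i => by fun_prop
  have hfin : ∀ I : Finset ℕ, ∃ x, ∀ i ∈ I, c / 4 * (N i : ℝ) ^ d ≤ ‖S i x‖ := by
    intro I
    obtain ⟨x, hx⟩ := hf.exists_norm_sum_centred_lt hm hj (fun n => norm_phase_le (w n)) hC I
      (fun i => box d (N i)) (fun i => c / 4 * (N i : ℝ) ^ d)
      (fun i => mul_pos (by positivity) (hNd i)) (by
        calc _ ≤ ∑ i ∈ I, 1 / 4 * (1 / 2 : ℝ) ^ i := by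
              refine Finset.sum_le_sum fun i _ => le_trans (le_of_eq ?_) (hNs i)
              have := (hNd i).ne'
              rw [card_box]
              push_cast
              field_simp
          _ ≤ 1 / 4 * 2 := by
              rw [← Finset.mul_sum]
              exact mul_le_mul_of_nonneg_left ((summable_geometric_two.sum_le_tsum _
                fun i _ => by positivity).trans_eq tsum_geometric_two) (by norm_num)
          _ < 1 := by norm_num)
    refine ⟨x, fun i hi => ?_⟩
    have h1 := hx i hi
    rw [sum_mul_centred_phase] at h1
    set A := ∑ n ∈ box d (N i) with residue m n = j, ‖w n‖
    -- The main term is at least `c/2 · N^d` and the deviation is below `c/4 · N^d`, which leaves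
    -- `c/4 · N^d`.
    have h2 : A / 2 - ‖S i x‖ ≤ ‖S i x - (A : ℂ) / 2‖ := by
      rw [norm_sub_rev]
      refine le_trans (sub_le_sub_right ?_ _) (norm_sub_norm_le _ _)
      rw [norm_div, Complex.norm_real, Complex.norm_ofNat]
      exact div_le_div_of_nonneg_right (le_abs_self A) (by norm_num)
    linarith [hNc i]
  -- By `hfin` these closed sets have the finite intersection property.
  obtain ⟨x, -, hx⟩ := isCompact_univ.inter_iInter_nonempty
    (fun i => {x | c / 4 * (N i : ℝ) ^ d ≤ ‖S i x‖})
    (fun i => isClosed_le continuous_const (hSc i).norm) (fun I => by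
      obtain ⟨x, hx⟩ := hfin I
      exact ⟨x, trivial, Set.mem_iInter₂.mpr hx⟩)
  rw [Set.mem_iInter] at hx
  refine ⟨c / 4, by positivity, x, frequently_atTop.mpr fun i => ⟨N i, hNi i, hN0 i, hx i⟩⟩

/-- The continuous function `x ↦ exp (2πi x₀)` on `X_f`. -/
def coordinateCharacter {d : ℕ} (f : LaurentRing d) : C(principalGroup f, ℂ) :=
  ⟨character f (monoNat 0), continuous_character _⟩

theorem coordinateCharacter_actNat {d : ℕ} (f : LaurentRing d) (n : Fin d → ℕ)
    (x : principalGroup f) :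
    coordinateCharacter f (actNat (principalAction f) n x) = character f (monoNat n) x := by
  change character f (monoNat 0) (shift f _ x) = _
  simp only [character, monoNat, mono, pairing_single, shift, one_smul]
  congr 2
  refine congrArg x.1 (funext fun i => ?_)
  simp

end BohrChaos

end

theorem theorem5p1 (d : ℕ) (hd : 1 ≤ d) (f : BohrChaos.LaurentRing d)
    (hf : ∃ m : ℕ, 1 ≤ m ∧ BohrChaos.IsGood m f) :
    BohrChaos.IsBohrChaotic (BohrChaos.principalAction f) := by
  obtain ⟨m, hm, hf⟩ := hf
  intro w hw
  obtain ⟨c, hc, x, hx⟩ := hf.exists_frequently_le_norm_sum hd hm hw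
  obtain ⟨⟨C, hC⟩, -⟩ := hw
  refine ⟨BohrChaos.coordinateCharacter f, x, hc.trans_le ?_⟩
  simp only [BohrChaos.coordinateCharacter_actNat]
  -- A real `limsup` is meaningful only for bounded sequences; the means are bounded by `C`,
  -- including the default value `0` at `N = 0`.
  refine le_limsup_of_frequently_le (hx.mono fun N hN => ?_) (isBoundedUnder_of ⟨C, fun N => ?_⟩)
  · rw [one_div, inv_mul_eq_div, le_div_iff₀ (pow_pos (by exact_mod_cast hN.1) d)]
    exact hN.2
  · rcases Nat.eq_zero_or_pos N with rfl | hN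
    · have hd0 : d ≠ 0 := by omega
      simpa [hd0] using (norm_nonneg _).trans (hC 0)
    · rw [one_div, inv_mul_eq_div, div_le_iff₀ (by positivity)]
      refine (norm_sum_le _ _).trans ?_
      have h : ∀ n ∈ BohrChaos.box d N,
          ‖w n * BohrChaos.character f (BohrChaos.monoNat n) x‖ ≤ C := fun n _ => by
        rw [norm_mul, BohrChaos.norm_character, mul_one]
        exact hC n
      refine (Finset.sum_le_card_nsmul _ _ _ h).trans (le_of_eq ?_)
      rw [BohrChaos.card_box, nsmul_eq_mul, mul_comm]
      push_cast
      rfl
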